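/- Let $\sigma_X>0$, $\rho\ge 0$, $r>\rho^2$, and let $(X,\theta)\sim\mathcal N\!\left(0,\ \sigma_X^2\begin{pmatrix}1&\rho\\ \rho&r\end{pmatrix}\right)$. An encoder is a stochastic map $g$ (a conditional law of a real signal $Y=g(X,\theta)$ given $(X,\theta)$). The decoder knows $g$, observes $Y$, and answers with a best response: a Borel map $h$ with $\mathbb E[h(Y)^2]<\infty$ that minimizes $\mathbb E[(X-h(Y))^2]$ among all such maps. Let $\sigma_X^2(r-\rho^2)\le D_P\le\sigma_X^2 r$. The privacy constraint, imposed on the encoder only, is either the entropy constraint $H(\theta\mid\hat X)\ge\tfrac12\log(2\pi e D_P)$ with $\hat X=h(Y)$ and $H$ the conditional differential entropy, or the MMSE constraint $\mathbb E[(\theta-\mathbb E[\theta\mid Y])^2]\ge D_P$. A Stackelberg equilibrium is a pair $(g,h)$, with $h$ a best response to $g$ and the privacy constraint satisfied, whose distortion $\mathbb E[(X-h(Y))^2]$ is minimal among all such pairs. Put $$\alpha=-\frac{\rho}{r}+\sqrt{\Bigl(1-\frac{\rho^2}{r}\Bigr)\Bigl(\frac{\sigma_X^2}{D_P}-\frac1r\Bigr)},\qquad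 \kappa=\frac{1+\alpha\rho}{1+\alpha^2r+2\alpha\rho}.$$ Then, for each of the two privacy constraints, the noiseless linear encoder $g(X,\theta)=X+\alpha\theta$ and the linear decoder $h(Y)=\kappa Y$ form a Stackelberg equilibrium. It is essentially unique: every Stackelberg equilibrium $(g,h)$ satisfies $h(Y)=\kappa(X+\alpha\theta)$ almost surely, and $\kappa>0$, so that $X+\alpha\theta$ can be recovered from $Y$. Moreover, adding independent noise is strictly suboptimal: if $Y=X+\beta\theta+S$ with $\beta\in\mathbb R$ and $S$ independent of $(X,\theta)$ and not almost surely constant, and if $Y$ with a best response satisfies the privacy constraint, then its distortion is strictly larger than the equilibrium distortion. -/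

import Mathlib

open MeasureTheory ProbabilityTheory

noncomputable section

namespace PrivacyGame

/-- `μ` is the law `N(0, σ² [[1, ρ], [ρ, r]])` of the pair `(X, θ)` on `ℝ × ℝ`
(first coordinate: the source `X`; second coordinate: the private information `θ`). -/
structure IsSourceLaw (μ : Measure (ℝ × ℝ)) (σ ρ r : ℝ) : Prop where
  gaussian : IsGaussian μ
  mean_fst : ∫ p, p.1 ∂μ = 0
  mean_snd : ∫ p, p.2 ∂μ = 0
  second_moment_fst : ∫ p, p.1 ^ 2 ∂μ = σ ^ 2
  cross_moment : ∫ p, p.1 * p.2 ∂μ = σ ^ 2 * ρ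
  second_moment_snd : ∫ p, p.2 ^ 2 ∂μ = σ ^ 2 * r

/-- The joint law of `((X, θ), Y)` when `(X, θ)` has law `μ` and the conditional law of `Y` given
`(X, θ)` is the (stochastic) encoder `g`. -/
def jointLaw (μ : Measure (ℝ × ℝ)) (g : Kernel (ℝ × ℝ) ℝ) : Measure ((ℝ × ℝ) × ℝ) :=
  μ ⊗ₘ g

/-- The decoders available against the encoder `g`: Borel maps `h` with `E[h(Y)²] < ∞`. -/
def IsDecoder (μ : Measure (ℝ × ℝ)) (g : Kernel (ℝ × ℝ) ℝ) (h : ℝ → ℝ) : Prop :=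
  Measurable h ∧ MemLp h 2 (jointLaw μ g).snd

/-- The mean squared error `D_C = E[(X - h(Y))²]`. -/
def distortion (μ : Measure (ℝ × ℝ)) (g : Kernel (ℝ × ℝ) ℝ) (h : ℝ → ℝ) : ℝ :=
  ∫ ω, (ω.1.1 - h ω.2) ^ 2 ∂(jointLaw μ g)

/-- `h` is a best response of the decoder (the follower) to the encoder `g`:
it minimizes the mean squared error, without regard to privacy. -/
def IsBestResponse (μ : Measure (ℝ × ℝ)) (g : Kernel (ℝ × ℝ) ℝ) (h : ℝ → ℝ) : Prop :=
  IsDecoder μ g h ∧ ∀ h' : ℝ → ℝ, IsDecoder μ g h' → distortion μ g h ≤ distortion μ g h'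

open Classical in
/-- The conditional differential entropy `H(T | Z) = E[-log p(T | Z)]` (natural logarithm) of a pair
`(Z, T)` with law `π` on `ℝ × ℝ`. The conditional density `p(t | z)` is the density of `π` with
respect to (law of `Z`) ⊗ Lebesgue; if there is none, the entropy is `-∞`. The expectation is the
difference of the integrals of the positive and the negative part. -/
def condDiffEntropy (π : Measure (ℝ × ℝ)) : EReal :=
  let lam : Measure (ℝ × ℝ) := π.fst.prod volume
  if π ≪ lam then
    ((∫⁻ q, ENNReal.ofReal (-Real.log (π.rnDeriv lam q).toReal) ∂π : ENNReal) : EReal)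
      - ((∫⁻ q, ENNReal.ofReal (Real.log (π.rnDeriv lam q).toReal) ∂π : ENNReal) : EReal)
  else ⊥

/-- A privacy constraint: a condition on the encoder and on the decoder's response. -/
abbrev PrivacyConstraint := Kernel (ℝ × ℝ) ℝ → (ℝ → ℝ) → Prop

/-- The entropy constraint `H(θ | X̂) ≥ J`, where `X̂ = h(Y)` is what the inspector observes. -/
def entropyPrivacy (μ : Measure (ℝ × ℝ)) (J : ℝ) : PrivacyConstraint := fun g h =>
  (J : EReal) ≤ condDiffEntropy ((jointLaw μ g).map (fun ω => (h ω.2, ω.1.2)))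

/-- The constraint `E[(θ - E[θ | Y])²] ≥ D`. -/
def mmsePrivacy (μ : Measure (ℝ × ℝ)) (D : ℝ) : PrivacyConstraint := fun g _ =>
  D ≤ ∫ ω, (ω.1.2 - ((jointLaw μ g)[fun ω' : (ℝ × ℝ) × ℝ => ω'.1.2 |
    MeasurableSpace.comap (Prod.snd : (ℝ × ℝ) × ℝ → ℝ) inferInstance]) ω) ^ 2 ∂(jointLaw μ g)

/-- `g` is a stochastic encoder, the decoder answers it optimally by `h`, and the privacy
constraint, which binds the encoder only, is met. -/
def IsAdmissible (μ : Measure (ℝ × ℝ)) (C : PrivacyConstraint)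
    (g : Kernel (ℝ × ℝ) ℝ) (h : ℝ → ℝ) : Prop :=
  IsMarkovKernel g ∧ IsBestResponse μ g h ∧ C g h

/-- `(g, h)` is an equilibrium of the constrained Stackelberg game with the encoder as leader. -/
def IsStackelbergEquilibrium (μ : Measure (ℝ × ℝ)) (C : PrivacyConstraint)
    (g : Kernel (ℝ × ℝ) ℝ) (h : ℝ → ℝ) : Prop :=
  IsAdmissible μ C g h ∧
    ∀ (g' : Kernel (ℝ × ℝ) ℝ) (h' : ℝ → ℝ), IsAdmissible μ C g' h' →
      distortion μ g h ≤ distortion μ g' h'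

/-- The noiseless encoder `Y = X + α θ`. -/
def linearEncoder (α : ℝ) : Kernel (ℝ × ℝ) ℝ :=
  Kernel.deterministic (fun p => p.1 + α * p.2) (by fun_prop)

/-- The encoder `Y = X + β θ + S` with `S` of law `ν`, independent of `(X, θ)`. -/
def noisyEncoder (β : ℝ) (ν : Measure ℝ) : Kernel (ℝ × ℝ) ℝ :=
  (Kernel.id ×ₖ Kernel.const (ℝ × ℝ) ν).map (fun q => q.1.1 + β * q.1.2 + q.2)

end PrivacyGame

end

/-!
For an admissible pair write `Z = h(Y)`, `v = E[Z²]` and `w = E[θ Z]`. Comparing the best response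
`h` with its multiples gives `E[X Z] = v`, so that the distortion is `σ² - v`, and `v` has to be
maximized (`PrivacyGame.IsBestResponse.integral_mul_eq`).

Either privacy constraint implies `E[(θ - a Z)²] ≥ D` for every real `a`, and hence
`w² ≤ v (σ² r - D)`. For the MMSE constraint this holds because `a Z` is a function of `Y`; for the
entropy constraint it is Gibbs' inequality against the Gaussian conditional density of mean `a z`
and variance `D` (`le_integral_sq_of_le_condDiffEntropy`).

Let `W = X + α θ`, let `v₀ = E[(κ W)²]`, and let `s = √(v / v₀)`. As `α ≤ 0 ≤ ρ + α r`, inserting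
the bound on `w` into `E[(Z - κ W)²] = v - 2 κ (v + α w) + v₀` yields
`0 ≤ E[(Z - κ W)²] ≤ v₀ (1 - s) (1 + (2 κ - 1) s)` with `κ ≥ 1`
(`EquilibriumGains.gap_le`). So `v ≤ v₀`, and `v = v₀` forces `Z = κ W` almost surely: this is
optimality and uniqueness at once (`second_moment_le`).

The linear pair attains the bound. The residuals `X - κ W` and `θ - c W`, for the regression
coefficient `c`, are Gaussian and uncorrelated with `W`, hence independent of it. So `κ W` is the
best response, and `θ` given `W` is Gaussian with conditional variance exactly `D`, which meets both
constraints with equality (`PrivacyGame.isAdmissible_linear`).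

If a noisy linear encoder were as good, uniqueness would give `h(X + β θ + S) = κ W`. Fixing the
value of `S`, this is impossible for `β ≠ α` because `W` is not a function of `X + β θ`, and for
`β = α` because it determines the value of `S` (`PrivacyGame.not_ae_eq_of_noise`).
-/

open scoped NNReal ENNReal

/-! ### Algebra of the equilibrium gains -/

/-- The algebraic facts about the gains `α` (of the encoder) and `κ` (of the decoder) that the
argument uses. Here `σ² (1 + α² r + 2 α ρ)` is the variance of `X + α θ`, so `kappa_mul` says that
`κ (X + α θ)` is the regression of `X` on `X + α θ`, and `cov_eq` says that the regression of `θ`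
on `X + α θ` leaves an error of variance exactly `D`. -/
structure EquilibriumGains (σ ρ r D α κ : ℝ) : Prop where
  sigma_pos : 0 < σ
  level_pos : 0 < D
  alpha_nonpos : α ≤ 0
  cov_theta_nonneg : 0 ≤ ρ + α * r
  cov_source_pos : 0 < 1 + α * ρ
  var_pos : 0 < 1 + α ^ 2 * r + 2 * α * ρ
  one_le_kappa : 1 ≤ κ
  kappa_mul : κ * (1 + α ^ 2 * r + 2 * α * ρ) = 1 + α * ρ
  cov_eq : σ ^ 2 * (r - ρ ^ 2) = D * (1 + α ^ 2 * r + 2 * α * ρ)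

theorem equilibriumGains {σ ρ r D α κ : ℝ} (hσ : 0 < σ) (hρ : 0 ≤ ρ) (hr : ρ ^ 2 < r)
    (hD_min : σ ^ 2 * (r - ρ ^ 2) ≤ D) (hD_max : D ≤ σ ^ 2 * r)
    (hα : α = -ρ / r + Real.sqrt ((1 - ρ ^ 2 / r) * (σ ^ 2 / D - 1 / r)))
    (hκ : κ = (1 + α * ρ) / (1 + α ^ 2 * r + 2 * α * ρ)) :
    EquilibriumGains σ ρ r D α κ := by
  have hr0 : 0 < r := lt_of_le_of_lt (sq_nonneg ρ) hr
  have hσ2 : 0 < σ ^ 2 := by positivity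
  have hD : 0 < D := lt_of_lt_of_le (mul_pos hσ2 (sub_pos.2 hr)) hD_min
  have h1 : 0 ≤ σ ^ 2 / D - 1 / r := by
    rw [sub_nonneg, div_le_div_iff₀ hr0 hD]; linarith
  have h2 : 0 ≤ 1 - ρ ^ 2 / r := by
    rw [sub_nonneg, div_le_one hr0]; exact hr.le
  set q := Real.sqrt ((1 - ρ ^ 2 / r) * (σ ^ 2 / D - 1 / r)) with hq
  have hq0 : 0 ≤ q := Real.sqrt_nonneg _
  have hqq : q ^ 2 = (1 - ρ ^ 2 / r) * (σ ^ 2 / D - 1 / r) := Real.sq_sqrt (mul_nonneg h2 h1)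
  have hu : ρ + α * r = r * q := by rw [hα]; field_simp; ring
  have hu2 : (ρ + α * r) ^ 2 * D = (r - ρ ^ 2) * (r * σ ^ 2 - D) := by
    rw [hu, mul_pow, hqq]; field_simp
  have hu0 : 0 ≤ ρ + α * r := by rw [hu]; positivity
  -- `D ≥ σ² (r - ρ²)` gives `(ρ + α r)² ≤ ρ²`, that is `α ≤ 0`
  have hα0 : α ≤ 0 := by
    have : (ρ + α * r) ^ 2 * D ≤ ρ ^ 2 * D := by
      rw [hu2]; nlinarith
    have h3 : ρ + α * r ≤ ρ := by
      have := le_of_mul_le_mul_right this hD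
      exact (pow_le_pow_iff_left₀ hu0 hρ two_ne_zero).1 this
    by_contra! hc
    nlinarith [mul_pos hc hr0]
  have hQ : r * (1 + α ^ 2 * r + 2 * α * ρ) = (ρ + α * r) ^ 2 + (r - ρ ^ 2) := by ring
  have hQ0 : 0 < 1 + α ^ 2 * r + 2 * α * ρ := by
    have : 0 < r * (1 + α ^ 2 * r + 2 * α * ρ) := by rw [hQ]; nlinarith [sq_nonneg (ρ + α * r)]
    exact pos_of_mul_pos_right this hr0.le
  have hp : 0 < 1 + α * ρ := by
    have : 0 < r * (1 + α * ρ) := by nlinarith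
    exact pos_of_mul_pos_right this hr0.le
  refine ⟨hσ, hD, hα0, hu0, hp, hQ0, ?_, by rw [hκ, div_mul_cancel₀ _ hQ0.ne'], ?_⟩
  · rw [hκ, le_div_iff₀ hQ0]; nlinarith [mul_nonneg (neg_nonneg.2 hα0) hu0]
  · have : r * (σ ^ 2 * (r - ρ ^ 2)) = r * (D * (1 + α ^ 2 * r + 2 * α * ρ)) := by
      calc _ = (r - ρ ^ 2) * (r * σ ^ 2 - D) + D * (r - ρ ^ 2) := by ring
        _ = _ := by rw [← hu2, mul_left_comm, hQ]; ring
    exact mul_left_cancel₀ hr0.ne' this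

namespace EquilibriumGains

variable {σ ρ r D α κ : ℝ}

theorem second_moment_pos (G : EquilibriumGains σ ρ r D α κ) :
    0 < κ * σ ^ 2 * (1 + α * ρ) := by
  have := G.one_le_kappa
  have := G.cov_source_pos
  have := G.sigma_pos
  positivity

/-- The heart of the optimality proof. Let `v` and `w` stand for `E[Z²]` and `E[θ Z]`, where
`E[X Z] = v`, so that the left-hand side is `E[(Z - κ (X + α θ))²]`. The privacy bound `hw` turns
the left-hand side into a quadratic in `s = √(v / v₀)`, with `v₀` the equilibrium second moment, and
this quadratic has the root `s = 1`. -/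
theorem gap_le (G : EquilibriumGains σ ρ r D α κ) {v w : ℝ}
    (hv : 0 ≤ v) (hw : w ^ 2 ≤ v * (σ ^ 2 * r - D)) :
    v - 2 * κ * (v + α * w) + κ * σ ^ 2 * (1 + α * ρ) ≤
      κ * σ ^ 2 * (1 + α * ρ) * ((1 - √(v / (κ * σ ^ 2 * (1 + α * ρ)))) *
        (1 + (2 * κ - 1) * √(v / (κ * σ ^ 2 * (1 + α * ρ))))) := by
  have hv₀ := G.second_moment_pos
  obtain ⟨hσ, -, hα, hu, hp, hQ, hκ1, hκQ, hD⟩ := G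
  set v₀ := κ * σ ^ 2 * (1 + α * ρ) with hv₀def
  set s := √(v / v₀) with hs
  have hs0 : 0 ≤ s := Real.sqrt_nonneg _
  have hsv : s ^ 2 * v₀ = v := by
    rw [hs, Real.sq_sqrt (by positivity)]; field_simp
  -- `τ` is the ratio `E[θ Z] / E[Z²]` at the equilibrium
  obtain ⟨τ, hτ⟩ : ∃ τ, τ * (1 + α * ρ) = ρ + α * r :=
    ⟨(ρ + α * r) / (1 + α * ρ), div_mul_cancel₀ _ hp.ne'⟩
  have hτ0 : 0 ≤ τ := nonneg_of_mul_nonneg_left (hτ ▸ hu) hp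
  have hκτ : κ * (1 + α * τ) = 1 := by
    refine mul_right_cancel₀ hp.ne' ?_
    linear_combination κ * α * hτ + hκQ
  have hDτ : τ ^ 2 * v₀ = σ ^ 2 * r - D := by
    refine mul_right_cancel₀ hQ.ne' ?_
    linear_combination (τ ^ 2 * σ ^ 2 * (1 + α * ρ)) * hκQ +
      σ ^ 2 * (τ * (1 + α * ρ) + ρ + α * r) * hτ - hD
  have hw' : w ≤ s * τ * v₀ := by
    refine (abs_le_of_sq_le_sq' ?_ (by positivity)).2
    rw [← hsv, ← hDτ] at hw
    linarith
  have h := mul_le_mul_of_nonneg_left hw' (mul_nonneg (by linarith : 0 ≤ κ) (neg_nonneg.2 hα))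
  have e : κ * -α * (s * τ * v₀) = (κ - 1) * s * v₀ := by
    linear_combination (-s * v₀) * hκτ
  rw [e] at h
  rw [← hsv]
  nlinarith

end EquilibriumGains

/-! ### The optimization problem in `L²` -/

section SquareIntegrable

variable {Ω : Type*} {mΩ : MeasurableSpace Ω} {P : Measure Ω}

theorem integral_sq_sub_const_mul {f g : Ω → ℝ} (hf : MemLp f 2 P) (hg : MemLp g 2 P) (c : ℝ) :
    ∫ ω, (f ω - c * g ω) ^ 2 ∂P =
      ∫ ω, f ω ^ 2 ∂P - 2 * c * ∫ ω, f ω * g ω ∂P + c ^ 2 * ∫ ω, g ω ^ 2 ∂P := by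
  have h1 := hf.integrable_sq
  have h2 : Integrable (fun ω => f ω * g ω) P := hf.integrable_mul hg
  have h3 := hg.integrable_sq
  rw [← integral_const_mul, ← integral_const_mul, ← integral_sub h1 (h2.const_mul _),
    ← integral_add (by exact h1.sub (h2.const_mul _)) (h3.const_mul _)]
  exact integral_congr_ae (.of_forall fun ω => by simp only; ring)

/-- If no multiple of `g` approximates `f` in mean square better than `D`, then the squared
correlation of `f` and `g` is at most `E[g²] (E[f²] - D)`. -/
theorem sq_integral_mul_le {f g : Ω → ℝ} (hf : MemLp f 2 P) (hg : MemLp g 2 P) {D : ℝ}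
    (h : ∀ a : ℝ, D ≤ ∫ ω, (f ω - a * g ω) ^ 2 ∂P) :
    (∫ ω, f ω * g ω ∂P) ^ 2 ≤ (∫ ω, g ω ^ 2 ∂P) * (∫ ω, f ω ^ 2 ∂P - D) := by
  have := discrim_le_zero (a := ∫ ω, g ω ^ 2 ∂P) (b := -2 * ∫ ω, f ω * g ω ∂P)
    (c := ∫ ω, f ω ^ 2 ∂P - D) fun a => by
      have := h a
      rw [integral_sq_sub_const_mul hf hg] at this
      linarith
  rw [discrim] at this
  linarith

/-- The optimization problem in `L²`. If `Z` satisfies the normal equation `E[X Z] = E[Z²]` and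
predicts `θ` linearly no better than up to the error `D`, then `E[Z²]` is at most its value for
`κ (X + α θ)`, and only `κ (X + α θ)` attains this value. -/
theorem second_moment_le {X θ Z : Ω → ℝ} (hX : MemLp X 2 P) (hθ : MemLp θ 2 P)
    (hZ : MemLp Z 2 P) {σ ρ r D α κ : ℝ} (G : EquilibriumGains σ ρ r D α κ)
    (hXX : ∫ ω, X ω ^ 2 ∂P = σ ^ 2) (hXθ : ∫ ω, X ω * θ ω ∂P = σ ^ 2 * ρ)
    (hθθ : ∫ ω, θ ω ^ 2 ∂P = σ ^ 2 * r)
    (hXZ : ∫ ω, X ω * Z ω ∂P = ∫ ω, Z ω ^ 2 ∂P)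
    (hpriv : ∀ a : ℝ, D ≤ ∫ ω, (θ ω - a * Z ω) ^ 2 ∂P) :
    ∫ ω, Z ω ^ 2 ∂P ≤ κ * σ ^ 2 * (1 + α * ρ) ∧
      (∫ ω, Z ω ^ 2 ∂P = κ * σ ^ 2 * (1 + α * ρ) →
        ∀ᵐ ω ∂P, Z ω = κ * (X ω + α * θ ω)) := by
  have hW : MemLp (fun ω => X ω + α * θ ω) 2 P := hX.add (hθ.const_mul α)
  have hWW : ∫ ω, (X ω + α * θ ω) ^ 2 ∂P = σ ^ 2 * (1 + α ^ 2 * r + 2 * α * ρ) := by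
    have := integral_sq_sub_const_mul hX hθ (-α)
    simp only [neg_mul, sub_neg_eq_add, hXX, hXθ, hθθ] at this
    rw [this]; ring
  have hZW : ∫ ω, Z ω * (X ω + α * θ ω) ∂P = ∫ ω, Z ω ^ 2 ∂P + α * ∫ ω, θ ω * Z ω ∂P := by
    rw [← hXZ, ← integral_const_mul, ← integral_add (by exact hX.integrable_mul hZ)
      (by exact (hθ.integrable_mul hZ).const_mul α)]
    exact integral_congr_ae (.of_forall fun ω => by simp only; ring)
  have hgap := integral_sq_sub_const_mul hZ hW κ
  have hgap' : ∫ ω, (Z ω - κ * (X ω + α * θ ω)) ^ 2 ∂P =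
      ∫ ω, Z ω ^ 2 ∂P - 2 * κ * (∫ ω, Z ω ^ 2 ∂P + α * ∫ ω, θ ω * Z ω ∂P) +
        κ * σ ^ 2 * (1 + α * ρ) := by
    rw [hgap, hZW, hWW, ← G.kappa_mul]; ring
  have hle := G.gap_le (v := ∫ ω, Z ω ^ 2 ∂P)
    (integral_nonneg fun ω => sq_nonneg _) (by rw [← hθθ]; exact sq_integral_mul_le hθ hZ hpriv)
  have hκ1 := G.one_le_kappa
  rw [← hgap'] at hle
  have hv₀ : 0 < κ * σ ^ 2 * (1 + α * ρ) := G.second_moment_pos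
  have hnn : 0 ≤ ∫ ω, (Z ω - κ * (X ω + α * θ ω)) ^ 2 ∂P := integral_nonneg fun ω => sq_nonneg _
  constructor
  · by_contra! hc
    have hs : 1 < Real.sqrt ((∫ ω, Z ω ^ 2 ∂P) / (κ * σ ^ 2 * (1 + α * ρ))) := by
      rw [Real.lt_sqrt zero_le_one, lt_div_iff₀ hv₀]; linarith
    have h1 := hnn.trans hle
    have h2 := nonneg_of_mul_nonneg_right h1 hv₀
    refine h2.not_gt (mul_neg_of_neg_of_pos (by linarith) ?_)
    nlinarith
  · intro heq
    rw [heq, div_self hv₀.ne', Real.sqrt_one, sub_self, zero_mul, mul_zero] at hle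
    have h0 := (integral_eq_zero_iff_of_nonneg (fun ω => sq_nonneg _)
      (hZ.sub (hW.const_mul κ)).integrable_sq).1 (le_antisymm hle hnn)
    filter_upwards [h0] with ω hω
    have : Z ω - κ * (X ω + α * θ ω) = 0 := pow_eq_zero_iff two_ne_zero |>.1 hω
    linarith

/-- The normal equation for an optimal scaling factor. -/
theorem integral_mul_eq_of_forall_le {f g : Ω → ℝ} (hf : MemLp f 2 P) (hg : MemLp g 2 P)
    (h : ∀ c : ℝ, ∫ ω, (f ω - g ω) ^ 2 ∂P ≤ ∫ ω, (f ω - c * g ω) ^ 2 ∂P) :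
    ∫ ω, f ω * g ω ∂P = ∫ ω, g ω ^ 2 ∂P := by
  have h1 : ∀ c : ℝ, 0 ≤ (∫ ω, g ω ^ 2 ∂P) * (c * c) + (-2 * ∫ ω, f ω * g ω ∂P) * c +
      (2 * ∫ ω, f ω * g ω ∂P - ∫ ω, g ω ^ 2 ∂P) := fun c => by
    have h1 := integral_sq_sub_const_mul hf hg 1
    have hc := h c
    simp only [one_mul] at h1
    rw [h1, integral_sq_sub_const_mul hf hg] at hc
    linarith
  have := discrim_le_zero h1
  rw [discrim] at this
  nlinarith [sq_nonneg (∫ ω, f ω * g ω ∂P - ∫ ω, g ω ^ 2 ∂P)]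

/-- The conditional expectation is the best mean square approximation of `f` by `m`-measurable
functions: subtracting `g` changes `f` and `P[f | m]` alike, and the expected conditional variance
of `f - g` is at most `E[(f - g)²]`. -/
theorem integral_sub_condExp_sq_le {m : MeasurableSpace Ω} (hm : m ≤ mΩ) [IsProbabilityMeasure P]
    {f g : Ω → ℝ} (hf : MemLp f 2 P) (hg : MemLp g 2 P) (hgm : StronglyMeasurable[m] g) :
    ∫ ω, (f ω - (P[f | m]) ω) ^ 2 ∂P ≤ ∫ ω, (f ω - g ω) ^ 2 ∂P := by
  have hfg := hf.sub hg
  have h := integral_condVar_add_variance_condExp hm hfg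
  have h1 : P[f - g | m] =ᵐ[P] P[f | m] - g := by
    have := condExp_sub (m := m) (hf.integrable one_le_two) (hg.integrable one_le_two)
    rwa [condExp_of_stronglyMeasurable hm hgm (hg.integrable one_le_two)] at this
  have h2 : ∫ ω, (Var[f - g; P | m]) ω ∂P = ∫ ω, (f ω - (P[f | m]) ω) ^ 2 ∂P := by
    rw [condVar, integral_condExp hm]
    refine integral_congr_ae ?_
    filter_upwards [h1] with ω hω
    simp [hω]
  rw [← h2]
  have h3 := variance_le_expectation_sq (X := f - g) hfg.1
  have h4 := variance_nonneg (P[f - g | m]) P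
  simp only [Pi.sub_apply, Pi.pow_apply] at h3
  linarith

end SquareIntegrable

/-! ### Conditional entropy against Gaussian densities -/

theorem neg_log_gaussianPDFReal (m : ℝ) {v : ℝ≥0} (hv : v ≠ 0) (t : ℝ) :
    -Real.log (gaussianPDFReal m v t) =
      1 / 2 * Real.log (2 * Real.pi * v) + (t - m) ^ 2 / (2 * v) := by
  have hv0 : (0 : ℝ) < v := by exact_mod_cast pos_iff_ne_zero.2 hv
  have hpos : 0 < 2 * Real.pi * v := by positivity
  rw [gaussianPDFReal, Real.log_mul (inv_ne_zero (Real.sqrt_pos.2 hpos).ne') (Real.exp_ne_zero _),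
    Real.log_exp, Real.log_inv, Real.log_sqrt hpos.le]
  ring

theorem half_log_two_pi_exp_one_mul {D : ℝ} (hD : 0 < D) :
    1 / 2 * Real.log (2 * Real.pi * Real.exp 1 * D) =
      1 / 2 * Real.log (2 * Real.pi * D) + 1 / 2 := by
  rw [mul_right_comm, Real.log_mul (by positivity) (Real.exp_ne_zero 1), Real.log_exp]
  ring

theorem coe_lintegral_sub_lintegral {α : Type*} {mα : MeasurableSpace α} {μ : Measure α}
    {f : α → ℝ} (hf : Integrable f μ) :
    ((∫⁻ x, ENNReal.ofReal (f x) ∂μ : ENNReal) : EReal) -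
      ((∫⁻ x, ENNReal.ofReal (-f x) ∂μ : ENNReal) : EReal) = ((∫ x, f x ∂μ : ℝ) : EReal) := by
  rw [integral_eq_lintegral_pos_part_sub_lintegral_neg_part hf, EReal.coe_sub,
    EReal.coe_ennreal_toReal hf.lintegral_lt_top.ne,
    EReal.coe_ennreal_toReal (by exact hf.neg.lintegral_lt_top.ne)]

theorem measurable_gaussianPDF_affine (c : ℝ) (v : ℝ≥0) :
    Measurable fun q : ℝ × ℝ => gaussianPDF (c * q.1) v q.2 := by
  have : Measurable fun q : ℝ × ℝ => ((c * q.1, v, q.2) : ℝ × ℝ≥0 × ℝ) := by fun_prop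
  exact measurable_uncurry_gaussianPDF.comp this

/-- The maximum entropy principle in the form needed here: conditional entropy at least that of
`N(0, D)` forces every linear prediction of the second coordinate from the first to have mean square
error at least `D`. This is Gibbs' inequality `E[log (G / p)] ≤ E[G / p] - 1 ≤ 0` for the conditional
density `p` and the Gaussian conditional density `G` with mean `a z` and variance `D`. -/
theorem le_integral_sq_of_le_condDiffEntropy {π : Measure (ℝ × ℝ)} [IsProbabilityMeasure π]
    {D a : ℝ} (hD : 0 < D) (hint : Integrable (fun q => (q.2 - a * q.1) ^ 2) π)
    (h : ((1 / 2 * Real.log (2 * Real.pi * Real.exp 1 * D) : ℝ) : EReal) ≤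
      PrivacyGame.condDiffEntropy π) :
    D ≤ ∫ q, (q.2 - a * q.1) ^ 2 ∂π := by
  rw [PrivacyGame.condDiffEntropy] at h
  split_ifs at h with hac
  swap
  · exact absurd (le_bot_iff.1 h) (EReal.coe_ne_bot _)
  set lam : Measure (ℝ × ℝ) := π.fst.prod volume with hlam
  set v : ℝ≥0 := D.toNNReal with hv
  have hvD : (v : ℝ) = D := Real.coe_toNNReal D hD.le
  have hv0 : v ≠ 0 := by simpa [hv] using hD
  set G : ℝ × ℝ → ℝ≥0∞ := fun q => gaussianPDF (a * q.1) v q.2 with hG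
  have hGm : Measurable G := measurable_gaussianPDF_affine a v
  have hG1 : ∫⁻ q, G q ∂lam = 1 := by
    rw [hlam, lintegral_prod _ hGm.aemeasurable]
    simp [hG, lintegral_gaussianPDF_eq_one _ hv0]
  set p := π.rnDeriv lam with hp
  have hpm : Measurable p := Measure.measurable_rnDeriv _ _
  have hGpm : Measurable fun q => G q / p q := hGm.div hpm
  have hGp : ∫⁻ q, G q / p q ∂π ≤ 1 := by
    rw [← lintegral_rnDeriv_mul hac hGpm.aemeasurable, ← hG1]
    exact lintegral_mono fun q => ENNReal.mul_div_le
  have hR : Integrable (fun q => (G q / p q).toReal) π :=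
    integrable_toReal_of_lintegral_ne_top hGpm.aemeasurable
      (hGp.trans_lt ENNReal.one_lt_top).ne
  have hp0 : ∀ᵐ q ∂π, 0 < p q := Measure.rnDeriv_pos hac
  have hptop : ∀ᵐ q ∂π, p q < ∞ := hac.ae_le (Measure.rnDeriv_lt_top π lam)
  have hR1 : ∫ q, (G q / p q).toReal ∂π ≤ 1 := by
    rw [integral_toReal hGpm.aemeasurable]
    · exact ENNReal.toReal_le_of_le_ofReal zero_le_one (by simpa using hGp)
    · filter_upwards [hp0] with q hq
      exact ENNReal.div_lt_top gaussianPDF_ne_top hq.ne'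
  -- `log x ≤ x - 1` at `x = G / p`
  have hle : ∀ᵐ q ∂π, -Real.log (p q).toReal ≤ 1 / 2 * Real.log (2 * Real.pi * D) +
      (q.2 - a * q.1) ^ 2 / (2 * D) + ((G q / p q).toReal - 1) := by
    filter_upwards [hp0, hptop] with q h0 h1
    have hpq : 0 < (p q).toReal := ENNReal.toReal_pos h0.ne' h1.ne
    have hGq : 0 < (G q).toReal := ENNReal.toReal_pos (gaussianPDF_pos _ hv0 _).ne'
      gaussianPDF_ne_top
    have hlog := neg_log_gaussianPDFReal (a * q.1) hv0 q.2
    rw [← toReal_gaussianPDF, show gaussianPDF (a * q.1) v q.2 = G q from rfl, hvD] at hlog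
    have := Real.log_le_sub_one_of_pos (div_pos hGq hpq)
    rw [Real.log_div hGq.ne' hpq.ne'] at this
    rw [ENNReal.toReal_div]
    linarith
  have hU : Integrable (fun q : ℝ × ℝ => 1 / 2 * Real.log (2 * Real.pi * D) +
      (q.2 - a * q.1) ^ 2 / (2 * D) + ((G q / p q).toReal - 1)) π :=
    ((integrable_const _).add (hint.div_const _)).add (hR.sub (integrable_const _))
  have hUint : ∫ q, (1 / 2 * Real.log (2 * Real.pi * D) +
      (q.2 - a * q.1) ^ 2 / (2 * D) + ((G q / p q).toReal - 1)) ∂π =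
      1 / 2 * Real.log (2 * Real.pi * D) + (∫ q, (q.2 - a * q.1) ^ 2 ∂π) / (2 * D) +
        (∫ q, (G q / p q).toReal ∂π - 1) := by
    rw [integral_add (by exact (integrable_const _).add (hint.div_const _))
      (by exact hR.sub (integrable_const _)), integral_add (integrable_const _)
      (by exact hint.div_const _), integral_sub hR (integrable_const _), integral_div]
    simp
  -- the positive part of `-log p` has a finite integral, and then so has the negative part,
  -- since otherwise the entropy would be `-∞`
  have hA : ∫⁻ q, ENNReal.ofReal (-Real.log (p q).toReal) ∂π ≠ ∞ := by
    refine ((lintegral_mono_ae ?_).trans_lt hU.lintegral_lt_top).ne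
    filter_upwards [hle] with q hq using ENNReal.ofReal_le_ofReal hq
  have hB : ∫⁻ q, ENNReal.ofReal (Real.log (p q).toReal) ∂π ≠ ∞ := by
    intro hB
    rw [hB, EReal.coe_ennreal_top, EReal.sub_top] at h
    exact EReal.coe_ne_bot _ (le_bot_iff.1 h)
  have hlogm : Measurable fun q => -Real.log (p q).toReal := hpm.ennreal_toReal.log.neg
  have hlogint : Integrable (fun q => -Real.log (p q).toReal) π := by
    refine ⟨hlogm.aestronglyMeasurable, ?_⟩
    rw [hasFiniteIntegral_iff_norm]
    calc ∫⁻ q, ENNReal.ofReal ‖-Real.log (p q).toReal‖ ∂π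
        ≤ ∫⁻ q, (ENNReal.ofReal (-Real.log (p q).toReal) +
            ENNReal.ofReal (Real.log (p q).toReal)) ∂π := by
          refine lintegral_mono fun q => ?_
          rcases le_total 0 (Real.log (p q).toReal) with h0 | h0
          · simp [abs_of_nonneg h0]
          · simp [abs_of_nonpos h0]
      _ < ∞ := by
          rw [lintegral_add_left hlogm.ennreal_ofReal]
          exact ENNReal.add_lt_top.2 ⟨hA.lt_top, hB.lt_top⟩
  have hval := coe_lintegral_sub_lintegral hlogint
  simp only [neg_neg] at hval
  rw [hval, EReal.coe_le_coe_iff, half_log_two_pi_exp_one_mul hD] at h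
  have h2 := integral_mono_ae hlogint hU hle
  rw [hUint] at h2
  have h3 : 1 / 2 ≤ (∫ q, (q.2 - a * q.1) ^ 2 ∂π) / (2 * D) := by linarith
  rw [le_div_iff₀ (by positivity)] at h3
  linarith

/-- For Gaussian `N` independent of `Z`, the conditional density of `c Z + N` given `Z = z` is that
of the Gaussian law with mean `c z`. -/
theorem map_prodMk_affine_eq_withDensity {Ω : Type*} {mΩ : MeasurableSpace Ω} {P : Measure Ω}
    [IsProbabilityMeasure P] {Z N : Ω → ℝ} (hZ : Measurable Z) (hN : Measurable N)
    (hZN : IndepFun Z N P) {v : ℝ≥0} (hv : v ≠ 0) (hNlaw : P.map N = gaussianReal 0 v) (c : ℝ) :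
    P.map (fun ω => (Z ω, c * Z ω + N ω)) =
      ((P.map Z).prod volume).withDensity fun q => gaussianPDF (c * q.1) v q.2 := by
  have hprob := Measure.isProbabilityMeasure_map (μ := P) hZ.aemeasurable
  have h1 : P.map (fun ω => (Z ω, c * Z ω + N ω)) =
      ((P.map Z).prod (gaussianReal 0 v)).map fun q => (q.1, c * q.1 + q.2) := by
    rw [← hNlaw, ← (indepFun_iff_map_prod_eq_prod_map_map hZ.aemeasurable hN.aemeasurable).1 hZN,
      Measure.map_map (by fun_prop) (by fun_prop)]
    rfl
  rw [h1]
  ext s hs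
  have hm : Measurable fun q : ℝ × ℝ => (q.1, c * q.1 + q.2) := by fun_prop
  rw [Measure.map_apply hm hs, Measure.prod_apply (hm hs), withDensity_apply _ hs,
    ← lintegral_indicator hs, lintegral_prod _
      ((measurable_gaussianPDF_affine c v).indicator hs).aemeasurable]
  refine lintegral_congr fun z => ?_
  have hsz : MeasurableSet (Prod.mk z ⁻¹' s) := measurable_prodMk_left hs
  have h2 : Prod.mk z ⁻¹' ((fun q : ℝ × ℝ => (q.1, c * q.1 + q.2)) ⁻¹' s) =
      (fun n => c * z + n) ⁻¹' (Prod.mk z ⁻¹' s) := rfl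
  rw [h2, ← Measure.map_apply (by fun_prop) hsz, gaussianReal_map_const_add, zero_add,
    gaussianReal_apply _ hv, ← lintegral_indicator hsz]
  rfl

/-- The conditional entropy of `c Z + N` given `Z`, for Gaussian `N` independent of `Z`, is the
entropy of `N`. -/
theorem condDiffEntropy_affine {Ω : Type*} {mΩ : MeasurableSpace Ω} {P : Measure Ω}
    [IsProbabilityMeasure P] {Z N : Ω → ℝ} (hZ : Measurable Z) (hN : Measurable N)
    (hZN : IndepFun Z N P) {v : ℝ≥0} (hv : v ≠ 0) (hNlaw : P.map N = gaussianReal 0 v) (c : ℝ) :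
    PrivacyGame.condDiffEntropy (P.map fun ω => (Z ω, c * Z ω + N ω)) =
      ((1 / 2 * Real.log (2 * Real.pi * Real.exp 1 * v) : ℝ) : EReal) := by
  have hprob := Measure.isProbabilityMeasure_map (μ := P) hZ.aemeasurable
  have hv0 : (0 : ℝ) < v := by exact_mod_cast pos_iff_ne_zero.2 hv
  have hdens := map_prodMk_affine_eq_withDensity hZ hN hZN hv hNlaw c
  set π := P.map fun ω => (Z ω, c * Z ω + N ω) with hπ
  have hm : Measurable fun ω => (Z ω, c * Z ω + N ω) := by fun_prop
  have hfst : π.fst = P.map Z := by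
    rw [hπ, Measure.fst_map_prodMk (by fun_prop)]
  have hac : π ≪ π.fst.prod volume := by
    rw [hfst, hdens]; exact withDensity_absolutelyContinuous _ _
  have hder : ∀ᵐ q ∂π, π.rnDeriv (π.fst.prod volume) q = gaussianPDF (c * q.1) v q.2 := by
    refine hac.ae_le ?_
    rw [hfst, hdens]
    exact Measure.rnDeriv_withDensity _ (measurable_gaussianPDF_affine c v)
  have hN2 : MemLp N 2 P := by
    have : MemLp id 2 (P.map N) := hNlaw ▸ memLp_id_gaussianReal 2
    exact (memLp_map_measure_iff (by fun_prop) hN.aemeasurable).1 this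
  have hNsq : ∫ ω, N ω ^ 2 ∂P = v := by
    have h1 : Var[fun x => x; P.map N] = v := by rw [hNlaw, variance_fun_id_gaussianReal]
    have h2 : ∫ x, x ∂P.map N = 0 := by rw [hNlaw, integral_id_gaussianReal]
    rw [variance_of_integral_eq_zero (by fun_prop) h2,
      integral_map hN.aemeasurable (by fun_prop)] at h1
    exact h1
  have hint : Integrable (fun q : ℝ × ℝ =>
      1 / 2 * Real.log (2 * Real.pi * v) + (q.2 - c * q.1) ^ 2 / (2 * v)) π := by
    rw [hπ, integrable_map_measure (by fun_prop) hm.aemeasurable]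
    simp only [Function.comp_def, add_sub_cancel_left]
    exact (integrable_const _).add (hN2.integrable_sq.div_const _)
  have hlog : ∀ᵐ q ∂π, -Real.log (π.rnDeriv (π.fst.prod volume) q).toReal =
      1 / 2 * Real.log (2 * Real.pi * v) + (q.2 - c * q.1) ^ 2 / (2 * v) := by
    filter_upwards [hder] with q hq
    rw [hq, toReal_gaussianPDF, neg_log_gaussianPDFReal _ hv]
  have hval := coe_lintegral_sub_lintegral (hint.congr (hlog.mono fun q hq => hq.symm))
  simp only [neg_neg] at hval
  rw [PrivacyGame.condDiffEntropy, if_pos hac, hval, integral_congr_ae hlog, hπ,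
    integral_map hm.aemeasurable (by fun_prop), half_log_two_pi_exp_one_mul hv0]
  simp only [add_sub_cancel_left]
  rw [integral_add (integrable_const _) (by exact hN2.integrable_sq.div_const _), integral_div,
    hNsq]
  simp only [integral_const, probReal_univ, one_smul]
  congr 2
  field_simp

/-! ### Linear forms of the Gaussian source -/

namespace PrivacyGame

namespace IsSourceLaw

variable {μ : Measure (ℝ × ℝ)} {σ ρ r : ℝ}

theorem memLp_fst (hμ : IsSourceLaw μ σ ρ r) : MemLp (fun p : ℝ × ℝ => p.1) 2 μ := by
  have := hμ.gaussian
  exact (IsGaussian.memLp_two_id (μ := μ)).fst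

theorem memLp_snd (hμ : IsSourceLaw μ σ ρ r) : MemLp (fun p : ℝ × ℝ => p.2) 2 μ := by
  have := hμ.gaussian
  exact (IsGaussian.memLp_two_id (μ := μ)).snd

theorem isProbabilityMeasure (hμ : IsSourceLaw μ σ ρ r) : IsProbabilityMeasure μ := by
  have := hμ.gaussian
  infer_instance

theorem memLp_linear (hμ : IsSourceLaw μ σ ρ r) (a b : ℝ) :
    MemLp (fun p : ℝ × ℝ => a * p.1 + b * p.2) 2 μ :=
  (hμ.memLp_fst.const_mul a).add (hμ.memLp_snd.const_mul b)

theorem integral_linear (hμ : IsSourceLaw μ σ ρ r) (a b : ℝ) :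
    ∫ p, (a * p.1 + b * p.2) ∂μ = 0 := by
  have := hμ.isProbabilityMeasure
  rw [integral_add ((hμ.memLp_fst.integrable one_le_two).const_mul a)
    ((hμ.memLp_snd.integrable one_le_two).const_mul b), integral_const_mul, integral_const_mul,
    hμ.mean_fst, hμ.mean_snd]
  simp

theorem integral_linear_mul_linear (hμ : IsSourceLaw μ σ ρ r) (a b c d : ℝ) :
    ∫ p, (a * p.1 + b * p.2) * (c * p.1 + d * p.2) ∂μ =
      σ ^ 2 * (a * c + (a * d + b * c) * ρ + b * d * r) := by
  have h1 : Integrable (fun p : ℝ × ℝ => a * c * p.1 ^ 2) μ :=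
    hμ.memLp_fst.integrable_sq.const_mul _
  have h2 : Integrable (fun p : ℝ × ℝ => (a * d + b * c) * (p.1 * p.2)) μ :=
    (hμ.memLp_fst.integrable_mul hμ.memLp_snd).const_mul _
  have h3 : Integrable (fun p : ℝ × ℝ => b * d * p.2 ^ 2) μ :=
    hμ.memLp_snd.integrable_sq.const_mul _
  calc ∫ p, (a * p.1 + b * p.2) * (c * p.1 + d * p.2) ∂μ
      = ∫ p, (a * c * p.1 ^ 2 + (a * d + b * c) * (p.1 * p.2) + b * d * p.2 ^ 2) ∂μ :=
        integral_congr_ae (.of_forall fun p => by simp only; ring)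
    _ = _ := by
        rw [integral_add (by exact h1.add h2) h3, integral_add h1 h2, integral_const_mul,
          integral_const_mul, integral_const_mul, hμ.second_moment_fst, hμ.cross_moment,
          hμ.second_moment_snd]
        ring

theorem hasGaussianLaw_linear_pair (hμ : IsSourceLaw μ σ ρ r) (a b c d : ℝ) :
    HasGaussianLaw (fun p : ℝ × ℝ => (a * p.1 + b * p.2, c * p.1 + d * p.2)) μ := by
  have := hμ.gaussian
  have h := (IsGaussian.hasGaussianLaw_id (μ := μ)).map_fun
    ((a • ContinuousLinearMap.fst ℝ ℝ ℝ + b • ContinuousLinearMap.snd ℝ ℝ ℝ).prod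
      (c • ContinuousLinearMap.fst ℝ ℝ ℝ + d • ContinuousLinearMap.snd ℝ ℝ ℝ))
  simpa using h

/-- Uncorrelated linear forms of the Gaussian pair `(X, θ)` are independent. -/
theorem indepFun_linear (hμ : IsSourceLaw μ σ ρ r) {a b c d : ℝ}
    (h : a * c + (a * d + b * c) * ρ + b * d * r = 0) :
    IndepFun (fun p : ℝ × ℝ => a * p.1 + b * p.2) (fun p : ℝ × ℝ => c * p.1 + d * p.2) μ := by
  have := hμ.isProbabilityMeasure
  refine (hμ.hasGaussianLaw_linear_pair a b c d).indepFun_of_covariance_eq_zero ?_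
  rw [covariance_eq_sub (hμ.memLp_linear a b) (hμ.memLp_linear c d), hμ.integral_linear a b,
    zero_mul, sub_zero]
  exact (hμ.integral_linear_mul_linear a b c d).trans (by rw [h, mul_zero])

theorem map_linear (hμ : IsSourceLaw μ σ ρ r) (a b : ℝ) :
    μ.map (fun p : ℝ × ℝ => a * p.1 + b * p.2) =
      gaussianReal 0 (σ ^ 2 * (a ^ 2 + 2 * a * b * ρ + b ^ 2 * r)).toNNReal := by
  rw [(hμ.hasGaussianLaw_linear_pair a b a b).fst.map_eq_gaussianReal, hμ.integral_linear,
    variance_of_integral_eq_zero (by fun_prop) (hμ.integral_linear a b)]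
  congr 2
  simp only [sq (_ + _ : ℝ), hμ.integral_linear_mul_linear]
  ring

end IsSourceLaw

/-! ### Privacy bounds the correlation of the reconstruction with `θ` -/

theorem IsDecoder.memLp {μ : Measure (ℝ × ℝ)} {g : Kernel (ℝ × ℝ) ℝ} {h : ℝ → ℝ}
    (hh : IsDecoder μ g h) : MemLp (fun ω : (ℝ × ℝ) × ℝ => h ω.2) 2 (jointLaw μ g) :=
  hh.2.comp_measurePreserving ⟨measurable_snd, rfl⟩

section JointLaw

variable {μ : Measure (ℝ × ℝ)} [IsProbabilityMeasure μ] {g : Kernel (ℝ × ℝ) ℝ} [IsMarkovKernel g]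

instance isProbabilityMeasure_jointLaw : IsProbabilityMeasure (jointLaw μ g) := by
  unfold jointLaw; infer_instance

theorem measurePreserving_fst_jointLaw :
    MeasurePreserving (Prod.fst : (ℝ × ℝ) × ℝ → ℝ × ℝ) (jointLaw μ g) μ :=
  ⟨measurable_fst, Measure.fst_compProd μ g⟩

theorem integral_fst_jointLaw {f : ℝ × ℝ → ℝ} (hf : Measurable f) :
    ∫ ω, f ω.1 ∂(jointLaw μ g) = ∫ p, f p ∂μ := by
  have h := measurePreserving_fst_jointLaw (μ := μ) (g := g)
  conv_rhs => rw [← h.map_eq, integral_map h.measurable.aemeasurable hf.aestronglyMeasurable]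

variable {σ ρ r : ℝ}

/-- Comparing a best response `h` with its multiples `c h` gives `E[X h(Y)] = E[h(Y)²]`. -/
theorem IsBestResponse.integral_mul_eq (hμ : IsSourceLaw μ σ ρ r) {h : ℝ → ℝ}
    (hh : IsBestResponse μ g h) :
    ∫ ω, ω.1.1 * h ω.2 ∂(jointLaw μ g) = ∫ ω, h ω.2 ^ 2 ∂(jointLaw μ g) :=
  integral_mul_eq_of_forall_le
    (hμ.memLp_fst.comp_measurePreserving measurePreserving_fst_jointLaw) hh.1.memLp
    fun c => hh.2 (fun y => c * h y) ⟨hh.1.1.const_mul c, hh.1.2.const_mul c⟩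

/-- Since `a h(Y)` is a function of `Y`, its error is at least that of `E[θ | Y]`. -/
theorem mmsePrivacy.le_integral_sq (hμ : IsSourceLaw μ σ ρ r) {h : ℝ → ℝ} (hh : IsDecoder μ g h)
    {D : ℝ} (hp : mmsePrivacy μ D g h) (a : ℝ) :
    D ≤ ∫ ω, (ω.1.2 - a * h ω.2) ^ 2 ∂(jointLaw μ g) :=
  le_trans hp <| integral_sub_condExp_sq_le measurable_snd.comap_le
    (hμ.memLp_snd.comp_measurePreserving measurePreserving_fst_jointLaw) (hh.memLp.const_mul a)
    ((hh.1.comp (comap_measurable Prod.snd)).const_mul a).stronglyMeasurable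

theorem entropyPrivacy.le_integral_sq (hμ : IsSourceLaw μ σ ρ r) {h : ℝ → ℝ}
    (hh : IsDecoder μ g h) {D : ℝ} (hD : 0 < D)
    (hp : entropyPrivacy μ (1 / 2 * Real.log (2 * Real.pi * Real.exp 1 * D)) g h) (a : ℝ) :
    D ≤ ∫ ω, (ω.1.2 - a * h ω.2) ^ 2 ∂(jointLaw μ g) := by
  have hm : Measurable fun ω : (ℝ × ℝ) × ℝ => (h ω.2, ω.1.2) :=
    (hh.1.comp measurable_snd).prodMk (by fun_prop)
  have := Measure.isProbabilityMeasure_map (μ := jointLaw μ g) hm.aemeasurable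
  have hθ : MemLp (fun ω : (ℝ × ℝ) × ℝ => ω.1.2) 2 (jointLaw μ g) :=
    hμ.memLp_snd.comp_measurePreserving measurePreserving_fst_jointLaw
  have h1 := le_integral_sq_of_le_condDiffEntropy (a := a) hD
    ((integrable_map_measure (by fun_prop) hm.aemeasurable).2
      (hθ.sub (hh.memLp.const_mul a)).integrable_sq) hp
  rwa [integral_map hm.aemeasurable (by fun_prop)] at h1

/-- Every admissible pair has at least the distortion of the linear pair, and one that attains it
reconstructs `κ (X + α θ)`. -/
theorem IsAdmissible.distortion_bound {D α κ : ℝ} (hμ : IsSourceLaw μ σ ρ r)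
    (G : EquilibriumGains σ ρ r D α κ) {C : PrivacyConstraint}
    (hC : C = entropyPrivacy μ (1 / 2 * Real.log (2 * Real.pi * Real.exp 1 * D)) ∨
      C = mmsePrivacy μ D) {h : ℝ → ℝ} (hadm : IsAdmissible μ C g h) :
    σ ^ 2 - κ * σ ^ 2 * (1 + α * ρ) ≤ distortion μ g h ∧
      (distortion μ g h = σ ^ 2 - κ * σ ^ 2 * (1 + α * ρ) →
        ∀ᵐ ω ∂(jointLaw μ g), h ω.2 = κ * (ω.1.1 + α * ω.1.2)) := by
  obtain ⟨-, hbest, hpriv⟩ := hadm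
  have hpriv' : ∀ a : ℝ, D ≤ ∫ ω, (ω.1.2 - a * h ω.2) ^ 2 ∂(jointLaw μ g) := by
    rcases hC with rfl | rfl
    · exact entropyPrivacy.le_integral_sq hμ hbest.1 G.level_pos hpriv
    · exact mmsePrivacy.le_integral_sq hμ hbest.1 hpriv
  have hX : MemLp (fun ω : (ℝ × ℝ) × ℝ => ω.1.1) 2 (jointLaw μ g) :=
    hμ.memLp_fst.comp_measurePreserving measurePreserving_fst_jointLaw
  have hθ : MemLp (fun ω : (ℝ × ℝ) × ℝ => ω.1.2) 2 (jointLaw μ g) :=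
    hμ.memLp_snd.comp_measurePreserving measurePreserving_fst_jointLaw
  have hXX : ∫ ω, ω.1.1 ^ 2 ∂(jointLaw μ g) = σ ^ 2 :=
    (integral_fst_jointLaw (f := fun p => p.1 ^ 2) (by fun_prop)).trans hμ.second_moment_fst
  have hXθ : ∫ ω, ω.1.1 * ω.1.2 ∂(jointLaw μ g) = σ ^ 2 * ρ :=
    (integral_fst_jointLaw (f := fun p => p.1 * p.2) (by fun_prop)).trans hμ.cross_moment
  have hθθ : ∫ ω, ω.1.2 ^ 2 ∂(jointLaw μ g) = σ ^ 2 * r :=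
    (integral_fst_jointLaw (f := fun p => p.2 ^ 2) (by fun_prop)).trans hμ.second_moment_snd
  obtain ⟨h1, h2⟩ := second_moment_le hX hθ hbest.1.memLp G hXX hXθ hθθ
    (hbest.integral_mul_eq hμ) hpriv'
  have hdist : distortion μ g h = σ ^ 2 - ∫ ω, h ω.2 ^ 2 ∂(jointLaw μ g) := by
    have := integral_sq_sub_const_mul hX hbest.1.memLp 1
    simp only [one_mul] at this
    rw [distortion, this, hXX, hbest.integral_mul_eq hμ]
    ring
  rw [hdist]
  exact ⟨by linarith, fun h => h2 (by linarith)⟩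

end JointLaw

/-! ### The linear pair is admissible -/

instance isMarkovKernel_linearEncoder (α : ℝ) : IsMarkovKernel (linearEncoder α) := by
  unfold linearEncoder; infer_instance

theorem jointLaw_linearEncoder (μ : Measure (ℝ × ℝ)) [SFinite μ] (α : ℝ) :
    jointLaw μ (linearEncoder α) = μ.map fun p => (p, p.1 + α * p.2) :=
  Measure.compProd_deterministic _

theorem integral_jointLaw_linearEncoder (μ : Measure (ℝ × ℝ)) [SFinite μ] (α : ℝ)
    {F : (ℝ × ℝ) × ℝ → ℝ} (hF : Measurable F) :
    ∫ ω, F ω ∂(jointLaw μ (linearEncoder α)) = ∫ p, F (p, p.1 + α * p.2) ∂μ := by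
  rw [jointLaw_linearEncoder, integral_map (by fun_prop) hF.aestronglyMeasurable]

/-- Subtracting an independent variable from a centred one does not decrease the second moment. -/
theorem integral_sq_le_integral_sub_sq_of_indepFun {Ω : Type*} {mΩ : MeasurableSpace Ω}
    {P : Measure Ω} {N Z : Ω → ℝ} (hN : MemLp N 2 P) (hZ : MemLp Z 2 P) (hN0 : ∫ ω, N ω ∂P = 0)
    (h : IndepFun N Z P) : ∫ ω, N ω ^ 2 ∂P ≤ ∫ ω, (N ω - Z ω) ^ 2 ∂P := by
  have h1 := integral_sq_sub_const_mul hN hZ 1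
  simp only [one_mul] at h1
  rw [h1, h.integral_fun_mul_eq_mul_integral hN.1 hZ.1, hN0]
  have : 0 ≤ ∫ ω, Z ω ^ 2 ∂P := integral_nonneg fun ω => sq_nonneg _
  linarith

section Linear

variable {μ : Measure (ℝ × ℝ)} {σ ρ r D α κ : ℝ}

theorem isDecoder_linear (hμ : IsSourceLaw μ σ ρ r) (c : ℝ) :
    IsDecoder μ (linearEncoder α) fun y => c * y := by
  have := hμ.isProbabilityMeasure
  refine ⟨by fun_prop, ?_⟩
  rw [Measure.snd, memLp_map_measure_iff (by fun_prop) (by fun_prop), jointLaw_linearEncoder,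
    memLp_map_measure_iff (by fun_prop) (by fun_prop)]
  exact (hμ.memLp_fst.add (hμ.memLp_snd.const_mul α)).const_mul c

theorem distortion_linear (hμ : IsSourceLaw μ σ ρ r) (G : EquilibriumGains σ ρ r D α κ) :
    distortion μ (linearEncoder α) (fun y => κ * y) = σ ^ 2 - κ * σ ^ 2 * (1 + α * ρ) := by
  have := hμ.isProbabilityMeasure
  rw [distortion, integral_jointLaw_linearEncoder _ _ (by fun_prop)]
  have := hμ.integral_linear_mul_linear (1 - κ) (-(κ * α)) (1 - κ) (-(κ * α))
  calc _ = ∫ p, ((1 - κ) * p.1 + -(κ * α) * p.2) * ((1 - κ) * p.1 + -(κ * α) * p.2) ∂μ :=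
        integral_congr_ae (.of_forall fun p => by simp only; ring)
    _ = _ := by
        rw [this]
        linear_combination σ ^ 2 * κ * G.kappa_mul

theorem isBestResponse_linear (hμ : IsSourceLaw μ σ ρ r) (G : EquilibriumGains σ ρ r D α κ) :
    IsBestResponse μ (linearEncoder α) fun y => κ * y := by
  have := hμ.isProbabilityMeasure
  refine ⟨isDecoder_linear hμ κ, fun h' hh' => ?_⟩
  have hmeas := hh'.1
  have hL2 : MemLp (fun p : ℝ × ℝ => h' (p.1 + α * p.2)) 2 μ := by
    have := hh'.memLp
    rw [jointLaw_linearEncoder] at this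
    exact this.comp_of_map (by fun_prop)
  have hW : MemLp (fun p : ℝ × ℝ => p.1 + α * p.2) 2 μ :=
    hμ.memLp_fst.add (hμ.memLp_snd.const_mul α)
  -- `X - κ W` is uncorrelated with `W = X + α θ`, hence independent of it
  have hind := hμ.indepFun_linear (a := 1 - κ) (b := -(κ * α)) (c := 1) (d := α)
    (by linear_combination -G.kappa_mul)
  have hφ : Measurable fun y => h' y - κ * y := hmeas.sub (by fun_prop)
  have hind' := hind.comp measurable_id hφ
  simp only [Function.comp_def, id, one_mul] at hind'
  have key := integral_sq_le_integral_sub_sq_of_indepFun (hμ.memLp_linear _ _)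
    (hL2.sub (hW.const_mul κ)) (hμ.integral_linear _ _) hind'
  rw [distortion, distortion, integral_jointLaw_linearEncoder _ _ (by fun_prop),
    integral_jointLaw_linearEncoder _ _ (by fun_prop)]
  convert! key using 3 with p p
  · simp only; ring
  · simp only [Pi.sub_apply]; ring

/-- The regression coefficient `c` of `θ` on `X + α θ` (first identity), and the variance of the
residual `θ - c (X + α θ)`, which is exactly `D` (second identity). -/
theorem exists_residual (G : EquilibriumGains σ ρ r D α κ) : ∃ c : ℝ,
    c * (1 + α ^ 2 * r + 2 * α * ρ) = ρ + α * r ∧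
    σ ^ 2 * ((-c) ^ 2 + 2 * -c * (1 - c * α) * ρ + (1 - c * α) ^ 2 * r) = D := by
  have hQ := G.var_pos
  refine ⟨(ρ + α * r) / (1 + α ^ 2 * r + 2 * α * ρ), div_mul_cancel₀ _ hQ.ne', ?_⟩
  generalize hc : (ρ + α * r) / (1 + α ^ 2 * r + 2 * α * ρ) = c
  rw [div_eq_iff hQ.ne'] at hc
  refine mul_right_cancel₀ hQ.ne' ?_
  rw [← G.cov_eq]
  linear_combination (-σ ^ 2 * c * (1 + α ^ 2 * r + 2 * α * ρ) + σ ^ 2 * (ρ + α * r)) * hc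

theorem indepFun_residual (hμ : IsSourceLaw μ σ ρ r) {c : ℝ}
    (hc : c * (1 + α ^ 2 * r + 2 * α * ρ) = ρ + α * r) :
    IndepFun (fun p : ℝ × ℝ => -c * p.1 + (1 - c * α) * p.2)
      (fun p : ℝ × ℝ => p.1 + α * p.2) μ := by
  simpa only [one_mul] using hμ.indepFun_linear (a := -c) (b := 1 - c * α) (c := 1) (d := α)
    (by linear_combination -hc)

/-- Given `κ (X + α θ)`, the conditional law of `θ` is Gaussian of variance `D`. -/
theorem entropyPrivacy_linear (hμ : IsSourceLaw μ σ ρ r) (G : EquilibriumGains σ ρ r D α κ) :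
    entropyPrivacy μ (1 / 2 * Real.log (2 * Real.pi * Real.exp 1 * D)) (linearEncoder α)
      (fun y => κ * y) := by
  have := hμ.isProbabilityMeasure
  obtain ⟨c, hc, hcD⟩ := exists_residual G
  have hκ0 : κ ≠ 0 := (zero_lt_one.trans_le G.one_le_kappa).ne'
  have hlaw := hμ.map_linear (-c) (1 - c * α)
  rw [hcD] at hlaw
  have hind : IndepFun (fun p : ℝ × ℝ => κ * (p.1 + α * p.2))
      (fun p : ℝ × ℝ => -c * p.1 + (1 - c * α) * p.2) μ :=
    (indepFun_residual hμ hc).symm.comp (φ := fun y => κ * y) (by fun_prop) measurable_id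
  have hent := condDiffEntropy_affine (by fun_prop) (by fun_prop) hind
    (by simpa using G.level_pos) hlaw (c / κ)
  rw [Real.coe_toNNReal D G.level_pos.le] at hent
  rw [entropyPrivacy, ← hent, jointLaw_linearEncoder, Measure.map_map (by fun_prop) (by fun_prop)]
  refine le_of_eq ?_
  congr 2
  ext p
  · simp
  · simp only [Function.comp_apply]
    field_simp
    ring

/-- The conditional expectation of `θ` is some function of `X + α θ`, of which the residual
`θ - c (X + α θ)`, of variance `D`, is independent; so its error is at least `D`. -/
theorem mmsePrivacy_linear (hμ : IsSourceLaw μ σ ρ r) (G : EquilibriumGains σ ρ r D α κ)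
    (h : ℝ → ℝ) : mmsePrivacy μ D (linearEncoder α) h := by
  have := hμ.isProbabilityMeasure
  obtain ⟨c, hc, hcD⟩ := exists_residual G
  set P := jointLaw μ (linearEncoder α) with hP
  have hind := indepFun_residual hμ hc
  rw [mmsePrivacy]
  set m : MeasurableSpace ((ℝ × ℝ) × ℝ) :=
    MeasurableSpace.comap (Prod.snd : (ℝ × ℝ) × ℝ → ℝ) inferInstance with hm
  obtain ⟨f, hf, hfe⟩ := (stronglyMeasurable_condExp (m := m) (μ := P)
    (f := fun ω' : (ℝ × ℝ) × ℝ => ω'.1.2)).measurable.exists_eq_measurable_comp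
  have hθ : MemLp (fun ω : (ℝ × ℝ) × ℝ => ω.1.2) 2 P :=
    hμ.memLp_snd.comp_measurePreserving measurePreserving_fst_jointLaw
  have hf2 : MemLp (fun p : ℝ × ℝ => f (p.1 + α * p.2)) 2 μ := by
    have h1 : MemLp (f ∘ Prod.snd) 2 P := hfe ▸ hθ.condExp one_le_two
    rw [hP, jointLaw_linearEncoder] at h1
    exact h1.comp_of_map (by fun_prop)
  rw [hfe]
  simp only [Function.comp_apply]
  rw [integral_jointLaw_linearEncoder _ _ (by fun_prop)]
  have hφ : Measurable fun y => f y - c * y := hf.sub (by fun_prop)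
  have hW : MemLp (fun p : ℝ × ℝ => p.1 + α * p.2) 2 μ :=
    hμ.memLp_fst.add (hμ.memLp_snd.const_mul α)
  have key := integral_sq_le_integral_sub_sq_of_indepFun (hμ.memLp_linear _ _)
    (hf2.sub (hW.const_mul c)) (hμ.integral_linear _ _) (hind.comp measurable_id hφ)
  have hvar := hμ.integral_linear_mul_linear (-c) (1 - c * α) (-c) (1 - c * α)
  simp only [← sq] at hvar
  rw [hvar] at key
  calc D = _ := hcD.symm
    _ = _ := by ring
    _ ≤ _ := key
    _ = _ := integral_congr_ae (.of_forall fun p => by simp only [Pi.sub_apply]; ring)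

theorem isAdmissible_linear (hμ : IsSourceLaw μ σ ρ r) (G : EquilibriumGains σ ρ r D α κ)
    {C : PrivacyConstraint}
    (hC : C = entropyPrivacy μ (1 / 2 * Real.log (2 * Real.pi * Real.exp 1 * D)) ∨
      C = mmsePrivacy μ D) :
    IsAdmissible μ C (linearEncoder α) fun y => κ * y := by
  refine ⟨inferInstance, isBestResponse_linear hμ G, ?_⟩
  rcases hC with rfl | rfl
  · exact entropyPrivacy_linear hμ G
  · exact mmsePrivacy_linear hμ G _

end Linear

/-! ### Independent noise -/

theorem variance_form_pos {ρ r : ℝ} (hr : ρ ^ 2 < r) (β : ℝ) :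
    0 < 1 + 2 * β * ρ + β ^ 2 * r := by
  nlinarith [sq_nonneg (1 + β * ρ), sq_nonneg β, sq_nonneg (β * ρ), sq_nonneg (ρ + β * r)]

theorem ae_ae_of_ae_jointLaw_noisyEncoder {μ : Measure (ℝ × ℝ)} [SFinite μ] {ν : Measure ℝ}
    [IsProbabilityMeasure ν] {β : ℝ} {p : (ℝ × ℝ) × ℝ → Prop} (hp : MeasurableSet {ω | p ω})
    (h : ∀ᵐ ω ∂(jointLaw μ (noisyEncoder β ν)), p ω) :
    ∀ᵐ s ∂ν, ∀ᵐ x ∂μ, p (x, x.1 + β * x.2 + s) := by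
  have hsf : IsSFiniteKernel (noisyEncoder β ν) := by unfold noisyEncoder; infer_instance
  refine (Measure.ae_ae_comm (p := fun x s => p (x, x.1 + β * x.2 + s)) ?_).1 ?_
  · have : Measurable fun q : (ℝ × ℝ) × ℝ => (q.1, q.1.1 + β * q.1.2 + q.2) := by fun_prop
    exact this hp
  · filter_upwards [Measure.ae_ae_of_ae_compProd h] with x hx
    rw [noisyEncoder, Kernel.map_apply _ (by fun_prop), Kernel.prod_apply, Kernel.id_apply,
      Kernel.const_apply, Measure.dirac_prod, Measure.map_map (by fun_prop) (by fun_prop)] at hx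
    have hx' := ae_of_ae_map (by fun_prop) hx
    exact hx'

/-- For `β ≠ α`, the residual of `X + α θ` after regression on `X + β θ` is independent of
`X + β θ` and has positive variance, so `X + α θ` is not a function of `X + β θ`. -/
theorem IsSourceLaw.not_ae_eq_comp {μ : Measure (ℝ × ℝ)} {σ ρ r : ℝ} (hμ : IsSourceLaw μ σ ρ r)
    (hσ : 0 < σ) (hr : ρ ^ 2 < r) {α β : ℝ} (hαβ : β ≠ α) {f : ℝ → ℝ} (hf : Measurable f) :
    ¬ ∀ᵐ p ∂μ, p.1 + α * p.2 = f (p.1 + β * p.2) := by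
  intro h
  have hpos := variance_form_pos hr β
  -- `c` is the regression coefficient of `X + α θ` on `X + β θ`
  obtain ⟨c, hc⟩ : ∃ c, c * (1 + 2 * β * ρ + β ^ 2 * r) = 1 + (α + β) * ρ + α * β * r :=
    ⟨_, div_mul_cancel₀ _ hpos.ne'⟩
  have hind := hμ.indepFun_linear (a := 1 - c) (b := α - c * β) (c := 1) (d := β)
    (by linear_combination -hc)
  simp only [one_mul] at hind
  have hφ : Measurable fun y => f y - c * y := hf.sub (by fun_prop)
  have hind' := hind.comp measurable_id hφ
  have hae : (fun p : ℝ × ℝ => (1 - c) * p.1 + (α - c * β) * p.2) =ᵐ[μ]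
      fun p => f (p.1 + β * p.2) - c * (p.1 + β * p.2) := by
    filter_upwards [h] with p hp
    rw [← hp]; ring
  have hmul := hind'.integral_fun_mul_eq_mul_integral (by fun_prop) (by fun_prop)
  simp only [Function.comp_apply, id] at hmul
  rw [hμ.integral_linear, zero_mul] at hmul
  have hvar := hμ.integral_linear_mul_linear (1 - c) (α - c * β) (1 - c) (α - c * β)
  have heq : ∫ p, ((1 - c) * p.1 + (α - c * β) * p.2) * ((1 - c) * p.1 + (α - c * β) * p.2) ∂μ
      = 0 := by
    rw [← hmul]
    refine integral_congr_ae ?_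
    filter_upwards [hae] with p hp
    rw [← hp]
  rw [heq] at hvar
  -- the vanishing variance is a positive definite form in `(1 - c, α - c β)`; both entries are zero
  have h0 := (mul_eq_zero.1 hvar.symm).resolve_left (by positivity)
  have h1 : (1 - c + (α - c * β) * ρ) ^ 2 + (α - c * β) ^ 2 * (r - ρ ^ 2) = 0 := by
    linear_combination h0
  have h2 : 0 ≤ (α - c * β) ^ 2 * (r - ρ ^ 2) := mul_nonneg (sq_nonneg _) (sub_pos.2 hr).le
  have h3 : (α - c * β) ^ 2 * (r - ρ ^ 2) = 0 := by nlinarith [sq_nonneg (1 - c + (α - c * β) * ρ)]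
  have h4 : α - c * β = 0 :=
    pow_eq_zero_iff two_ne_zero |>.1 ((mul_eq_zero.1 h3).resolve_right (sub_pos.2 hr).ne')
  rw [h4] at h1
  have h5 : c = 1 := by nlinarith
  rw [h5] at h4
  exact hαβ (by linarith)

theorem _root_.MeasureTheory.Measure.eq_dirac_of_ae_eq {ν : Measure ℝ} [IsProbabilityMeasure ν]
    {c : ℝ} (h : ∀ᵐ s ∂ν, s = c) : ν = Measure.dirac c := by
  have h1 : ν.map id = ν.map fun _ => c := Measure.map_congr h
  rwa [Measure.map_id, Measure.map_const, measure_univ, one_smul] at h1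

/-- No decoder recovers `κ (X + α θ)` from `X + β θ + S` when `S` is independent noise that is not
almost surely constant. Fixing the value `s` of `S`: for `β ≠ α` a single `s` already gives a
contradiction; for `β = α` one gets `h y = κ (y - s)` for almost every `y`, which determines `s`. -/
theorem not_ae_eq_of_noise {μ : Measure (ℝ × ℝ)} {σ ρ r : ℝ} (hμ : IsSourceLaw μ σ ρ r)
    (hσ : 0 < σ) (hr : ρ ^ 2 < r) {α β κ : ℝ} (hκ : κ ≠ 0) {ν : Measure ℝ}
    [IsProbabilityMeasure ν] (hν : ∀ c : ℝ, ν ≠ Measure.dirac c) {h : ℝ → ℝ} (hh : Measurable h) :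
    ¬ ∀ᵐ ω ∂(jointLaw μ (noisyEncoder β ν)), h ω.2 = κ * (ω.1.1 + α * ω.1.2) := by
  intro hae
  have := hμ.isProbabilityMeasure
  have hfub := ae_ae_of_ae_jointLaw_noisyEncoder
    (p := fun ω => h ω.2 = κ * (ω.1.1 + α * ω.1.2))
    (measurableSet_eq_fun (hh.comp measurable_snd) (by fun_prop)) hae
  simp only at hfub
  by_cases hαβ : β = α
  · subst hαβ
    have hpos : 0 < σ ^ 2 * (1 ^ 2 + 2 * 1 * β * ρ + β ^ 2 * r) := by
      have := variance_form_pos hr β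
      refine mul_pos (by positivity) ?_
      linarith
    have hlaw := hμ.map_linear 1 β
    simp only [one_mul] at hlaw
    -- the law of `X + β θ` has the same null sets as Lebesgue measure, which is shift invariant
    have hshift : ∀ᵐ s ∂ν, ∀ᵐ y : ℝ, h y = κ * (y - s) := by
      filter_upwards [hfub] with s hs
      have h1 : ∀ᵐ w ∂(μ.map fun p : ℝ × ℝ => p.1 + β * p.2), h (w + s) = κ * w :=
        (ae_map_iff (by fun_prop) (measurableSet_eq_fun (hh.comp (by fun_prop)) (by fun_prop))).2 hs
      rw [hlaw] at h1
      have h2 : ∀ᵐ w : ℝ, h (w + s) = κ * w :=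
        (gaussianReal_absolutelyContinuous' 0 (by simpa using hpos)).ae_le h1
      have h3 := (measurePreserving_sub_right volume s).quasiMeasurePreserving.ae h2
      filter_upwards [h3] with y hy
      simpa using hy
    obtain ⟨s, hs⟩ := hshift.exists
    refine hν s (Measure.eq_dirac_of_ae_eq ?_)
    filter_upwards [hshift] with s' hs'
    obtain ⟨y, hy, hy'⟩ := (hs.and hs').exists
    have := mul_left_cancel₀ hκ (hy'.symm.trans hy)
    linarith
  · obtain ⟨s, hs⟩ := hfub.exists
    refine hμ.not_ae_eq_comp hσ hr hαβ (f := fun u => h (u + s) / κ)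
      ((hh.comp (by fun_prop)).div_const κ) ?_
    filter_upwards [hs] with p hp
    rw [hp]; field_simp

end PrivacyGame

theorem theorem2
    (σ ρ r D : ℝ) (hσ : 0 < σ) (hρ : 0 ≤ ρ) (hr : ρ ^ 2 < r)
    (hD_min : σ ^ 2 * (r - ρ ^ 2) ≤ D) (hD_max : D ≤ σ ^ 2 * r)
    (μ : Measure (ℝ × ℝ)) (hμ : PrivacyGame.IsSourceLaw μ σ ρ r)
    (α κ : ℝ)
    (hα : α = -ρ / r + Real.sqrt ((1 - ρ ^ 2 / r) * (σ ^ 2 / D - 1 / r)))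
    (hκ : κ = (1 + α * ρ) / (1 + α ^ 2 * r + 2 * α * ρ))
    (C : PrivacyGame.PrivacyConstraint)
    (hC : C = PrivacyGame.entropyPrivacy μ (1 / 2 * Real.log (2 * Real.pi * Real.exp 1 * D)) ∨
      C = PrivacyGame.mmsePrivacy μ D) :
    -- the noiseless linear encoder and the linear decoder form an equilibrium
    PrivacyGame.IsStackelbergEquilibrium μ C (PrivacyGame.linearEncoder α) (fun y => κ * y) ∧
    -- essential uniqueness: every equilibrium yields the same reconstruction
    (∀ (g : Kernel (ℝ × ℝ) ℝ) (h : ℝ → ℝ), PrivacyGame.IsStackelbergEquilibrium μ C g h →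
      ∀ᵐ ω ∂(PrivacyGame.jointLaw μ g), h ω.2 = κ * (ω.1.1 + α * ω.1.2)) ∧
    -- so that the linear signal can be recovered from every equilibrium signal
    0 < κ ∧
    -- adding independent noise is strictly suboptimal
    (∀ (β : ℝ) (ν : Measure ℝ), IsProbabilityMeasure ν → (∀ c : ℝ, ν ≠ Measure.dirac c) →
      ∀ h : ℝ → ℝ, PrivacyGame.IsAdmissible μ C (PrivacyGame.noisyEncoder β ν) h →
        PrivacyGame.distortion μ (PrivacyGame.linearEncoder α) (fun y => κ * y) <
          PrivacyGame.distortion μ (PrivacyGame.noisyEncoder β ν) h) := by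
  have hprob := hμ.isProbabilityMeasure
  have G := equilibriumGains hσ hρ hr hD_min hD_max hα hκ
  have hκ0 : 0 < κ := zero_lt_one.trans_le G.one_le_kappa
  have hlin := PrivacyGame.distortion_linear hμ G
  have hadm := PrivacyGame.isAdmissible_linear hμ G hC
  refine ⟨⟨hadm, fun g' h' h => ?_⟩, fun g h heq => ?_, hκ0, fun β ν hν hν' h hh => ?_⟩
  · have := h.1
    exact hlin ▸ (h.distortion_bound hμ G hC).1
  · have := heq.1.1
    obtain ⟨h1, h2⟩ := heq.1.distortion_bound hμ G hC
    exact h2 (le_antisymm (hlin ▸ heq.2 _ _ hadm) h1)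
  · have := hh.1
    obtain ⟨h1, h2⟩ := hh.distortion_bound hμ G hC
    rw [hlin]
    exact lt_of_le_of_ne h1 fun he =>
      PrivacyGame.not_ae_eq_of_noise hμ hσ hr hκ0.ne' hν' hh.2.1.1.1 (h2 he.symm)
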